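/- Let $N,M_1,M_2,N_b\ge 1$ and $K\ge 0$ be integers with $M:=M_1+M_2\le N$, let $\sigma_0>0$, $\sigma_x\ge 0$ and $\gamma\in\mathbb R$, and let $H\in\mathbb R^{N\times K}$. Let $\rho_1^2\ge\rho_2^2\ge\dots\ge\rho_N^2\ge 0$ be the eigenvalues of $HH^T$, counted with multiplicity, and let $H=UDV^T$ be a singular value decomposition with singular values in decreasing order ($U\in\mathbb R^{N\times N}$ and $V\in\mathbb R^{K\times K}$ orthogonal, $D\in\mathbb R^{N\times K}$ diagonal with nonnegative decreasing diagonal entries). Let $U_s$ and $U_o$ consist of the first $M_1$ and of the last $M_2$ columns of $U$, let $T_s\in\mathbb R^{M_1\times M_1}$ and $T_o\in\mathbb R^{M_2\times M_2}$ be orthogonal, and set $$\Phi_s=\tfrac1{\sqrt M}T_sU_s^T,\qquad \Phi_o=\tfrac1{\sqrt M}T_oU_o^T,\qquad \Phi=\begin{bmatrix}\Phi_s\\ \Phi_o\end{bmatrix}.$$ Denote the $m$-th row of $\Phi$ by $\phi_m^T$. For $n=1,\dots,N_b$ and $m=1,\dots,M$ let $x[n]\sim\mathcal N(0,\sigma_x^2I_K)$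 and $w_m[n]\sim\mathcal N(0,\sigma_0^2I_N)$ be mutually independent random vectors, and let $w^\phi[n]=(\phi_1^Tw_1[n],\dots,\phi_M^Tw_M[n])^T$. Consider the hypotheses $$\mathcal H_0:\ z[n]=w^\phi[n],\qquad \mathcal H_1:\ z[n]=\Phi Hx[n]+w^\phi[n]\qquad(n=1,\dots,N_b),$$ let $z_s[n]$ and $z_o[n]$ be the first $M_1$ and the last $M_2$ entries of $z[n]$, and consider the test which decides for $\mathcal H_1$ if and only if $\mathcal T>\gamma$, where $$\mathcal T=\frac{\frac1{M_1N_b}\sum_{n=1}^{N_b}\|z_s[n]\|^2}{\frac1{M_2N_b}\sum_{n=1}^{N_b}\|z_o[n]\|^2}.$$ Let $P_{FA}$ and $P_D$ be the probabilities of $\mathcal T>\gamma$ under $\mathcal H_0$ and under $\mathcal H_1$. Then $$P_{FA}=Q_{F(M_1N_b,M_2N_b)}(\gamma),$$ $$Q_{F(M_1N_b,M_2N_b)}(\eta_{lb}\gamma)\le P_D\le Q_{F(M_1N_b,M_2N_b)}(\eta_{ub}\gamma),$$ where $$\eta_{lb}=\frac{\sigma_0^2+\sigma_x^2\rho_{N-M_2+1}^2}{\sigma_0^2+\sigma_x^2\rho_{M_1}^2},\qquad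 \eta_{ub}=\frac{\sigma_0^2+\sigma_x^2\rho_N^2}{\sigma_0^2+\sigma_x^2\rho_1^2},$$ and $Q_{F(d_1,d_2)}(t)=\Pr(F>t)$ is the tail probability of the $F$-distribution with $d_1$ and $d_2$ degrees of freedom, i.e. of $F=(X_1/d_1)/(X_2/d_2)$ for independent chi-squared variables $X_1,X_2$ with $d_1,d_2$ degrees of freedom. -/

import Mathlib

open MeasureTheory ProbabilityTheory
open scoped Matrix

noncomputable section

namespace CompressiveDetection

/-! ### The `F`-distribution -/

/-- The chi-squared distribution with `d` degrees of freedom: the law of the sum of the squares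
of `d` independent standard normal variables. -/
def chiSquared (d : ℕ) : Measure ℝ :=
  (Measure.pi fun _ : Fin d => gaussianReal 0 1).map fun v => ∑ i, v i ^ 2

/-- The `F`-distribution with `d₁` and `d₂` degrees of freedom: the law of
`(X₁ / d₁) / (X₂ / d₂)` for independent chi-squared variables `X₁`, `X₂` with `d₁`, `d₂` degrees
of freedom. -/
def fDistribution (d₁ d₂ : ℕ) : Measure ℝ :=
  ((chiSquared d₁).prod (chiSquared d₂)).map fun p => (p.1 / d₁) / (p.2 / d₂)

/-- The tail probability of the `F`-distribution with `d₁` and `d₂` degrees of freedom at `x`. -/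
def QF (d₁ d₂ : ℕ) (x : ℝ) : ℝ :=
  (fDistribution d₁ d₂).real (Set.Ioi x)

/-! ### Eigenvalues and singular vectors of the subspace matrix -/

/-- `H * Hᵀ` is symmetric. -/
theorem isHermitian_mul_transpose {N K : ℕ} (H : Matrix (Fin N) (Fin K) ℝ) :
    (H * Hᵀ).IsHermitian := by
  simpa [Matrix.conjTranspose_eq_transpose_of_trivial] using
    Matrix.isHermitian_mul_conjTranspose_self H

/-- `rhoSq H i` is the `i`-th largest eigenvalue `ρ_i²` of `H * Hᵀ`, counted with multiplicity,
for `1 ≤ i ≤ N` (the numbering starts at `1`). -/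
def rhoSq {N K : ℕ} (H : Matrix (Fin N) (Fin K) ℝ) (i : ℕ) : ℝ :=
  if h : 1 ≤ i ∧ i ≤ N then
    (isHermitian_mul_transpose H).eigenvalues₀ ⟨i - 1, by rw [Fintype.card_fin]; omega⟩
  else 0

/-- `H = U * D * Vᵀ` is a singular value decomposition of `H`: `U` and `V` are orthogonal, `D` is
(rectangular) diagonal and its diagonal entries are nonnegative and in decreasing order. -/
structure IsSVD {N K : ℕ} (H : Matrix (Fin N) (Fin K) ℝ) (U : Matrix (Fin N) (Fin N) ℝ)
    (D : Matrix (Fin N) (Fin K) ℝ) (V : Matrix (Fin K) (Fin K) ℝ) : Prop where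
  left_orthogonal : U ∈ Matrix.orthogonalGroup (Fin N) ℝ
  right_orthogonal : V ∈ Matrix.orthogonalGroup (Fin K) ℝ
  eq_mul : H = U * D * Vᵀ
  diagonal : ∀ (i : Fin N) (j : Fin K), (i : ℕ) ≠ (j : ℕ) → D i j = 0
  nonneg : ∀ (i : Fin N) (j : Fin K), (i : ℕ) = (j : ℕ) → 0 ≤ D i j
  antitone : ∀ (i i' : Fin N) (j j' : Fin K), (i : ℕ) = (j : ℕ) → (i' : ℕ) = (j' : ℕ) →
    i ≤ i' → D i' j' ≤ D i j

/-! ### The measurement design -/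

/-- The first `M₁` columns of `U`. -/
def firstCols {N M₁ : ℕ} (h : M₁ ≤ N) (U : Matrix (Fin N) (Fin N) ℝ) :
    Matrix (Fin N) (Fin M₁) ℝ :=
  U.submatrix id (Fin.castLE h)

/-- The last `M₂` columns of `U`, in their order in `U`. -/
def lastCols {N M₂ : ℕ} (h : M₂ ≤ N) (U : Matrix (Fin N) (Fin N) ℝ) :
    Matrix (Fin N) (Fin M₂) ℝ :=
  U.submatrix id fun i => ⟨N - M₂ + i, by omega⟩

/-- The max-energy sampler `Φ_s = M^{-1/2} T_s U_sᵀ`, where `M = M₁ + M₂`. -/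
def maxEnergySampler {N M₁ M₂ : ℕ} (h : M₁ + M₂ ≤ N) (U : Matrix (Fin N) (Fin N) ℝ)
    (Ts : Matrix (Fin M₁) (Fin M₁) ℝ) : Matrix (Fin M₁) (Fin N) ℝ :=
  (1 / Real.sqrt (M₁ + M₂ : ℕ)) • (Ts * (firstCols (by omega : M₁ ≤ N) U)ᵀ)

/-- The min-energy sampler `Φ_o = M^{-1/2} T_o U_oᵀ`, where `M = M₁ + M₂`. -/
def minEnergySampler {N M₁ M₂ : ℕ} (h : M₁ + M₂ ≤ N) (U : Matrix (Fin N) (Fin N) ℝ)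
    (To : Matrix (Fin M₂) (Fin M₂) ℝ) : Matrix (Fin M₂) (Fin N) ℝ :=
  (1 / Real.sqrt (M₁ + M₂ : ℕ)) • (To * (lastCols (by omega : M₂ ≤ N) U)ᵀ)

/-- The measurement matrix: the rows of `Φ_s` above the rows of `Φ_o`. The measurement devices
are indexed by `Fin M₁ ⊕ Fin M₂`. -/
def designMatrix {N M₁ M₂ : ℕ} (h : M₁ + M₂ ≤ N) (U : Matrix (Fin N) (Fin N) ℝ)
    (Ts : Matrix (Fin M₁) (Fin M₁) ℝ) (To : Matrix (Fin M₂) (Fin M₂) ℝ) :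
    Matrix (Fin M₁ ⊕ Fin M₂) (Fin N) ℝ :=
  Matrix.fromRows (maxEnergySampler h U Ts) (minEnergySampler h U To)

/-! ### Signal, noise and measurements -/

/-- The random model over `N_b` snapshots and measurement devices `ι`: signal coefficients
`x[n] ∼ N(0, σx² I_K)` and noise vectors `w_m[n] ∼ N(0, σ0² I_N)` at the input of device `m`, all
of them mutually independent. -/
structure IsSignalNoiseModel {Ω : Type*} [MeasurableSpace Ω] (P : Measure Ω)
    {ι : Type*} {K N Nb : ℕ} (σx σ0 : ℝ)
    (x : Fin Nb → Ω → EuclideanSpace ℝ (Fin K))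
    (w : Fin Nb → ι → Ω → EuclideanSpace ℝ (Fin N)) : Prop where
  law_signal : ∀ n, HasLaw (x n) (multivariateGaussian 0 (σx ^ 2 • 1)) P
  law_noise : ∀ n m, HasLaw (w n m) (multivariateGaussian 0 (σ0 ^ 2 • 1)) P
  indep_signal : iIndepFun x P
  indep_noise : iIndepFun (fun p : Fin Nb × ι => w p.1 p.2) P
  indep_signal_noise : IndepFun (fun ω n => x n ω) (fun ω (p : Fin Nb × ι) => w p.1 p.2 ω) P

/-- The measurements under the null hypothesis: device `m` outputs `φ_mᵀ w_m`, where `φ_m` is the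
`m`-th row of `Φ`. -/
def measurementNull {ι : Type*} {N : ℕ} (Φ : Matrix ι (Fin N) ℝ)
    (w : ι → EuclideanSpace ℝ (Fin N)) : ι → ℝ :=
  fun m => Φ m ⬝ᵥ (w m).ofLp

/-- The measurements under the alternative hypothesis: `Φ H x` plus the noise outputs. -/
def measurementAlt {ι : Type*} {N K : ℕ} (Φ : Matrix ι (Fin N) ℝ) (H : Matrix (Fin N) (Fin K) ℝ)
    (x : EuclideanSpace ℝ (Fin K)) (w : ι → EuclideanSpace ℝ (Fin N)) : ι → ℝ :=
  Φ *ᵥ (H *ᵥ x.ofLp) + measurementNull Φ w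

/-! ### The test -/

/-- The ratio of the energies of the two blocks `z_s`, `z_o` of the measurements, each energy
being divided by its number of samples, `M₁ N_b` and `M₂ N_b` respectively. -/
def testStatistic {M₁ M₂ Nb : ℕ} (z : Fin Nb → Fin M₁ ⊕ Fin M₂ → ℝ) : ℝ :=
  ((∑ n, (z n ∘ Sum.inl) ⬝ᵥ (z n ∘ Sum.inl)) / (M₁ * Nb : ℕ)) /
    ((∑ n, (z n ∘ Sum.inr) ⬝ᵥ (z n ∘ Sum.inr)) / (M₂ * Nb : ℕ))

/-- The probability that the test with threshold `γ` decides for the alternative hypothesis when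
the measurements are `z[n]`. -/
def rejectionProb {Ω : Type*} [MeasurableSpace Ω] (P : Measure Ω) {M₁ M₂ Nb : ℕ}
    (z : Fin Nb → Ω → Fin M₁ ⊕ Fin M₂ → ℝ) (γ : ℝ) : ℝ :=
  P.real {ω | γ < testStatistic fun n => z n ω}

/-- The factor `η_lb`. -/
def etaLB {N K : ℕ} (H : Matrix (Fin N) (Fin K) ℝ) (σ0 σx : ℝ) (M₁ M₂ : ℕ) : ℝ :=
  (σ0 ^ 2 + σx ^ 2 * rhoSq H (N - M₂ + 1)) / (σ0 ^ 2 + σx ^ 2 * rhoSq H M₁)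

/-- The factor `η_ub`. -/
def etaUB {N K : ℕ} (H : Matrix (Fin N) (Fin K) ℝ) (σ0 σx : ℝ) : ℝ :=
  (σ0 ^ 2 + σx ^ 2 * rhoSq H N) / (σ0 ^ 2 + σx ^ 2 * rhoSq H 1)

end CompressiveDetection

end

open CompressiveDetection

open CompressiveDetection

/-! ### Eigenvalues from a singular value decomposition -/

namespace CompressiveDetection

/-! Rotating the blocks by `Tsᵀ` and `Toᵀ` leaves their energies unchanged and turns the rows of the
design into columns of `U`, scaled by `M^{-1/2}`. These columns diagonalise `H * Hᵀ`. The noise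
outputs are independent with common variance `σ0² / M`, so they stay white under the rotation. The
rotated measurements are thus jointly Gaussian and uncorrelated, hence independent, with variances
`α_i / M`, where `α_i = σ0² + σx² ρ_i²` (`exists_standardized_energies`).

The block energies are therefore weighted sums of squares of standard normals. The weights lie in
`[α_{M₁}, α_1]` in the first block and in `[α_N, α_{N-M₂+1}]` in the second. Replacing each weight
by an extreme one compares the test statistic, outcome by outcome, with a multiple of an
`F`-distributed ratio `F`: it is at least `F / η_lb` and at most `F / η_ub`. Inclusion of events
gives both bounds on the detection probability.

The null hypothesis is the case `H = 0` with the same design: both factors are then `1` and the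
bounds coincide. -/

theorem mul_transpose_of_mem_orthogonalGroup {n : ℕ} {T : Matrix (Fin n) (Fin n) ℝ}
    (hT : T ∈ Matrix.orthogonalGroup (Fin n) ℝ) : T * Tᵀ = 1 := by
  simpa [Matrix.star_eq_conjTranspose] using (Matrix.mem_orthogonalGroup_iff _ _).1 hT

theorem transpose_mul_of_mem_orthogonalGroup {n : ℕ} {T : Matrix (Fin n) (Fin n) ℝ}
    (hT : T ∈ Matrix.orthogonalGroup (Fin n) ℝ) : Tᵀ * T = 1 := by
  simpa [Matrix.star_eq_conjTranspose] using (Matrix.mem_orthogonalGroup_iff' _ _).1 hT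

end CompressiveDetection

/-- The only antitone enumeration of the eigenvalues of a Hermitian matrix with multiplicities is
`eigenvalues₀`. -/
theorem eigenvalues₀_eq_of_charpoly_eq {N : ℕ} {A : Matrix (Fin N) (Fin N) ℝ} (hA : A.IsHermitian)
    {d : Fin N → ℝ} (hd : Antitone d) (h : A.charpoly = (Matrix.diagonal d).charpoly)
    (i : Fin (Fintype.card (Fin N))) :
    hA.eigenvalues₀ i = d (Fin.cast (Fintype.card_fin N) i) := by
  have hsort := hA.sort_roots_charpoly_eq_eigenvalues₀
  rw [h, Matrix.charpoly_diagonal, Polynomial.roots_prod _ _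
    (Finset.prod_ne_zero_iff.2 fun i _ => Polynomial.X_sub_C_ne_zero _)] at hsort
  simp only [Polynomial.roots_X_sub_C, Multiset.bind_singleton, Multiset.map_map] at hsort
  -- The enumeration `d` is already decreasing, so sorting leaves it alone.
  have h2 : (Multiset.map (RCLike.re ∘ d) Finset.univ.val).sort (· ≥ ·) = List.ofFn d := by
    rw [Fin.univ_val_map, Multiset.coe_sort]
    apply List.mergeSort_of_pairwise
    simp_rw [decide_eq_true_eq, ← List.sortedGE_iff_pairwise]
    exact hd.sortedGE_ofFn
  rw [h2] at hsort
  have hi : (i : ℕ) < (List.ofFn hA.eigenvalues₀).length := by simpa using i.2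
  have hi' : (i : ℕ) < (List.ofFn d).length := hsort ▸ hi
  have := List.getElem_of_eq hsort hi'
  rw [List.getElem_ofFn, List.getElem_ofFn] at this
  exact this.symm

namespace CompressiveDetection.IsSVD

variable {N K : ℕ} {H : Matrix (Fin N) (Fin K) ℝ} {U : Matrix (Fin N) (Fin N) ℝ}
  {D : Matrix (Fin N) (Fin K) ℝ} {V : Matrix (Fin K) (Fin K) ℝ}

theorem mul_transpose_eq_diagonal (h : IsSVD H U D V) :
    D * Dᵀ = Matrix.diagonal fun i => ∑ j, D i j ^ 2 := by
  ext i i'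
  rw [Matrix.mul_apply]
  by_cases hi : i = i'
  · subst hi
    simp [sq]
  · rw [Matrix.diagonal_apply_ne _ hi]
    refine Finset.sum_eq_zero fun j _ => ?_
    rw [Matrix.transpose_apply]
    by_cases hj : (i : ℕ) = j
    · rw [h.diagonal i' j fun h' => hi (Fin.ext (hj.trans h'.symm)), mul_zero]
    · rw [h.diagonal i j hj, zero_mul]

theorem antitone_sum_sq (h : IsSVD H U D V) : Antitone fun i => ∑ j, D i j ^ 2 := by
  intro i i' hii
  dsimp only
  by_cases hK : (i' : ℕ) < K
  · have key (k : Fin N) (hk : (k : ℕ) < K) : ∑ j, D k j ^ 2 = D k ⟨k, hk⟩ ^ 2 := by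
      refine Finset.sum_eq_single _ (fun j _ hj => ?_) (by simp)
      rw [h.diagonal k j fun h' => hj (Fin.ext h'.symm), zero_pow two_ne_zero]
    have hK' : (i : ℕ) < K := lt_of_le_of_lt hii hK
    rw [key i' hK, key i hK']
    exact pow_le_pow_left₀ (h.nonneg _ _ rfl) (h.antitone i i' ⟨i, hK'⟩ ⟨i', hK⟩ rfl rfl hii) 2
  -- When `N > K`, rows beyond the `K`-th are zero, so they come last in the order.
  · rw [Finset.sum_eq_zero fun j _ => ?_]
    · exact Finset.sum_nonneg fun j _ => sq_nonneg _
    · rw [h.diagonal i' j (by omega), zero_pow two_ne_zero]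

theorem mul_self_transpose (h : IsSVD H U D V) : H * Hᵀ = U * (D * Dᵀ) * Uᵀ := by
  have hV : Vᵀ * V = 1 :=
    transpose_mul_of_mem_orthogonalGroup h.right_orthogonal
  rw [h.eq_mul, Matrix.transpose_mul, Matrix.transpose_mul, Matrix.transpose_transpose]
  calc U * D * Vᵀ * (V * (Dᵀ * Uᵀ)) = U * D * (Vᵀ * V) * (Dᵀ * Uᵀ) := by
        simp only [Matrix.mul_assoc]
    _ = _ := by rw [hV]; simp only [Matrix.mul_assoc, Matrix.mul_one]

theorem left_transpose_mul (h : IsSVD H U D V) : Uᵀ * U = 1 :=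
  transpose_mul_of_mem_orthogonalGroup h.left_orthogonal

/-- `H * Hᵀ` is orthogonally similar to the diagonal matrix `D * Dᵀ`, whose entries already
decrease. This ties the numbering of the columns of `U` to that of the eigenvalues; the shift by one
is due to `rhoSq` starting at `1`. -/
theorem rhoSq_eq (h : IsSVD H U D V) (i : Fin N) : rhoSq H (i + 1) = ∑ j, D i j ^ 2 := by
  have hU := h.left_transpose_mul
  have hchar : (H * Hᵀ).charpoly = (Matrix.diagonal fun i => ∑ j, D i j ^ 2).charpoly := by
    rw [h.mul_self_transpose, h.mul_transpose_eq_diagonal, Matrix.mul_assoc,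
      Matrix.charpoly_mul_comm, Matrix.mul_assoc, hU, Matrix.mul_one]
  rw [rhoSq, dif_pos ⟨by omega, by omega⟩, eigenvalues₀_eq_of_charpoly_eq
    (isHermitian_mul_transpose H) h.antitone_sum_sq hchar]
  rfl

/-- Any orthogonal `U` serves for the zero matrix, so the design built from the singular vectors of
`H` remains admissible when `H` is replaced by `0`. -/
theorem zero (hU : U ∈ Matrix.orthogonalGroup (Fin N) ℝ)
    (hV : V ∈ Matrix.orthogonalGroup (Fin K) ℝ) : IsSVD 0 U 0 V where
  left_orthogonal := hU
  right_orthogonal := hV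
  eq_mul := by simp
  diagonal := by simp
  nonneg := by simp
  antitone := by simp

end CompressiveDetection.IsSVD

theorem CompressiveDetection.rhoSq_zero {N K : ℕ} (i : ℕ) :
    rhoSq (0 : Matrix (Fin N) (Fin K) ℝ) i = 0 := by
  by_cases h : 1 ≤ i ∧ i ≤ N
  · have := (IsSVD.zero (one_mem (Matrix.orthogonalGroup (Fin N) ℝ))
      (one_mem (Matrix.orthogonalGroup (Fin K) ℝ))).rhoSq_eq ⟨i - 1, by omega⟩
    simpa [Nat.sub_add_cancel h.1] using this
  · rw [rhoSq, dif_neg h]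

/-! ### The tail of the `F`-distribution -/

section FDistribution

variable {Ω ι κ : Type*} [MeasurableSpace Ω] {P : Measure Ω} [Fintype ι] [Fintype κ]

theorem hasLaw_sum_sq_chiSquared {g : ι → Ω → ℝ} (hlaw : ∀ i, HasLaw (g i) (gaussianReal 0 1) P)
    (hg : iIndepFun g P) {d : ℕ} (hd : Fintype.card ι = d) :
    HasLaw (fun ω => ∑ i, g i ω ^ 2) (chiSquared d) P := by
  let e : Fin d ≃ ι := (Fintype.equivFinOfCardEq hd).symm
  have h1 := (hg.precomp e.injective).hasLaw_pi fun i => hlaw (e i)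
  have h2 : HasLaw (fun v : Fin d → ℝ => ∑ i, v i ^ 2) (chiSquared d)
      (Measure.pi fun _ : Fin d => gaussianReal 0 1) := 
    ⟨(by fun_prop : Measurable _).aemeasurable, rfl⟩
  convert h2.fun_comp h1 using 2 with ω
  exact (e.sum_comp fun i => g i ω ^ 2).symm

theorem measureReal_ratio_eq_QF {g : ι ⊕ κ → Ω → ℝ}
    (hlaw : ∀ i, HasLaw (g i) (gaussianReal 0 1) P) (hg : iIndepFun g P) {d₁ d₂ : ℕ}
    (h₁ : Fintype.card ι = d₁) (h₂ : Fintype.card κ = d₂) (t : ℝ) :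
    P.real {ω | t < ((∑ i, g (.inl i) ω ^ 2) / d₁) / ((∑ i, g (.inr i) ω ^ 2) / d₂)} =
      QF d₁ d₂ t := by
  classical
  have := hg.isProbabilityMeasure
  have hS := hasLaw_sum_sq_chiSquared (fun i => hlaw (.inl i)) (hg.precomp Sum.inl_injective) h₁
  have hO := hasLaw_sum_sq_chiSquared (fun i => hlaw (.inr i)) (hg.precomp Sum.inr_injective) h₂
  -- Numerator and denominator depend on disjoint subfamilies of `g`.
  have hind := hg.indepFun_finset₀ (Finset.univ.map .inl) (Finset.univ.map .inr)
    (by simp [Finset.disjoint_left]) fun i => (hlaw i).aemeasurable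
  have hφ : Measurable fun v : (Finset.univ.map .inl : Finset (ι ⊕ κ)) → ℝ =>
      ∑ i : ι, v ⟨.inl i, by simp⟩ ^ 2 := by fun_prop
  have hψ : Measurable fun v : (Finset.univ.map .inr : Finset (ι ⊕ κ)) → ℝ =>
      ∑ i : κ, v ⟨.inr i, by simp⟩ ^ 2 := by fun_prop
  have hSO : IndepFun (fun ω => ∑ i, g (.inl i) ω ^ 2) (fun ω => ∑ i, g (.inr i) ω ^ 2) P :=
    hind.comp hφ hψ
  have : IsFiniteMeasure (chiSquared d₁) := by
    rw [← hS.map_eq]; infer_instance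
  have : IsFiniteMeasure (chiSquared d₂) := by
    rw [← hO.map_eq]; infer_instance
  have hpair := (indepFun_iff_hasLaw_prodMk_prod hS hO).1 hSO
  have hF : HasLaw (fun p : ℝ × ℝ => (p.1 / d₁) / (p.2 / d₂)) (fDistribution d₁ d₂)
      ((chiSquared d₁).prod (chiSquared d₂)) := 
    ⟨(by fun_prop : Measurable _).aemeasurable, rfl⟩
  exact (hF.fun_comp hpair).measureReal_eq (p := fun y => t < y) measurableSet_Ioi

end FDistribution

/-! ### Linear images of the Gaussian model -/

section GaussianModel

variable {Ω : Type*} [MeasurableSpace Ω] {P : Measure Ω}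

theorem ProbabilityTheory.HasGaussianLaw.comp_isLinearMap {E F : Type*}
    [NormedAddCommGroup E] [NormedSpace ℝ E] [FiniteDimensional ℝ E] [MeasurableSpace E]
    [BorelSpace E] [NormedAddCommGroup F] [NormedSpace ℝ F] [MeasurableSpace F] [BorelSpace F]
    {X : Ω → E} (hX : HasGaussianLaw X P) {f : E → F} (hf : IsLinearMap ℝ f) :
    HasGaussianLaw (fun ω => f (X ω)) P :=
  hX.map_fun (hf.mk' f).toContinuousLinearMap

theorem isLinearMap_dotProduct_ofLp {K : ℕ} (a : Fin K → ℝ) :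
    IsLinearMap ℝ fun v : EuclideanSpace ℝ (Fin K) => a ⬝ᵥ v.ofLp :=
  ⟨fun u v => by simp, fun c v => by simp⟩

theorem posSemidef_sq_smul_one (K : ℕ) (s : ℝ) :
    (s ^ 2 • (1 : Matrix (Fin K) (Fin K) ℝ)).PosSemidef :=
  Matrix.PosSemidef.one.smul (sq_nonneg s)

section IsotropicFamily

variable {ι : Type*} {K : ℕ} {s : ℝ} {X : ι → Ω → EuclideanSpace ℝ (Fin K)}

theorem hasGaussianLaw_dotProduct
    (hlaw : ∀ p, HasLaw (X p) (multivariateGaussian 0 (s ^ 2 • 1)) P) (p : ι) (a : Fin K → ℝ) :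
    HasGaussianLaw (fun ω => a ⬝ᵥ (X p ω).ofLp) P :=
  (hlaw p).hasGaussianLaw.comp_isLinearMap (isLinearMap_dotProduct_ofLp a)

theorem integral_dotProduct_eq_zero
    (hlaw : ∀ p, HasLaw (X p) (multivariateGaussian 0 (s ^ 2 • 1)) P) (p : ι) (a : Fin K → ℝ) :
    ∫ ω, a ⬝ᵥ (X p ω).ofLp ∂P = 0 := by
  let L := ((isLinearMap_dotProduct_ofLp a).mk' _).toContinuousLinearMap
  have h1 : ∫ ω, X p ω ∂P = 0 := by
    rw [(hlaw p).integral_eq, integral_id_multivariateGaussian]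
  have h2 := L.integral_comp_comm (hlaw p).hasGaussianLaw.integrable
  rw [h1, map_zero] at h2
  exact h2

theorem covariance_dotProduct [DecidableEq ι]
    (hlaw : ∀ p, HasLaw (X p) (multivariateGaussian 0 (s ^ 2 • 1)) P) (hX : iIndepFun X P)
    (p q : ι) (a b : Fin K → ℝ) :
    cov[fun ω => a ⬝ᵥ (X p ω).ofLp, fun ω => b ⬝ᵥ (X q ω).ofLp; P] =
      if p = q then s ^ 2 * (a ⬝ᵥ b) else 0 := by
  have hmeas (c : Fin K → ℝ) : Measurable fun v : EuclideanSpace ℝ (Fin K) => c ⬝ᵥ v.ofLp :=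
    ((isLinearMap_dotProduct_ofLp c).mk' _).toContinuousLinearMap.measurable
  split_ifs with hpq
  · subst hpq
    rw [(hlaw p).covariance_fun_comp (f := fun v => a ⬝ᵥ v.ofLp) (g := fun v => b ⬝ᵥ v.ofLp)
      (hmeas a).aemeasurable (hmeas b).aemeasurable]
    -- As an inner product, the functional has its covariance given by `covarianceBilin`.
    have hc (c : Fin K → ℝ) : (fun v : EuclideanSpace ℝ (Fin K) => c ⬝ᵥ v.ofLp) =
        fun v => inner ℝ (WithLp.toLp 2 c) v := by
      ext v; simp [EuclideanSpace.inner_eq_star_dotProduct, dotProduct_comm]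
    rw [hc, hc, ← covarianceBilin_apply_eq_cov IsGaussian.memLp_two_id,
      covarianceBilin_multivariateGaussian (posSemidef_sq_smul_one K s)]
    simp [Matrix.smul_mulVec]
  · exact ((hX.indepFun hpq).comp (hmeas a) (hmeas b)).covariance_eq_zero
      (hasGaussianLaw_dotProduct hlaw p a).memLp_two (hasGaussianLaw_dotProduct hlaw q b).memLp_two

end IsotropicFamily

namespace CompressiveDetection.IsSignalNoiseModel

variable {ι : Type*} [Fintype ι] {K N Nb : ℕ} {σx σ0 : ℝ}
  {x : Fin Nb → Ω → EuclideanSpace ℝ (Fin K)} {w : Fin Nb → ι → Ω → EuclideanSpace ℝ (Fin N)}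

/-- The `i`-th entry of `A x[n] + R u[n]`, where `u[n]` has the entries `φ_mᵀ w_m[n]`. -/
def _root_.CompressiveDetection.linearOutput {κ : Type*} (A : Matrix κ (Fin K) ℝ)
    (R : Matrix κ ι ℝ) (Φ : Matrix ι (Fin N) ℝ) (x : EuclideanSpace ℝ (Fin K))
    (w : ι → EuclideanSpace ℝ (Fin N)) (i : κ) : ℝ :=
  A i ⬝ᵥ x.ofLp + ∑ m, R i m * (Φ m ⬝ᵥ (w m).ofLp)

/-- Joint Gaussianity over all snapshots and entries is needed to pass from zero covariance to
independence. All signals and noises together form a Gaussian vector by independence, and the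
outputs are a linear image of it. -/
theorem hasGaussianLaw_linearOutput {κ : Type*} [Finite κ] (h : IsSignalNoiseModel P σx σ0 x w)
    (A : Matrix κ (Fin K) ℝ) (R : Matrix κ ι ℝ) (Φ : Matrix ι (Fin N) ℝ) :
    HasGaussianLaw (fun ω (p : Fin Nb × κ) =>
      linearOutput A R Φ (x p.1 ω) (fun m => w p.1 m ω) p.2) P := by
  have := Fintype.ofFinite κ
  have hx := h.indep_signal.hasGaussianLaw fun n => (h.law_signal n).hasGaussianLaw
  have hw := h.indep_noise.hasGaussianLaw fun p : Fin Nb × ι => (h.law_noise p.1 p.2).hasGaussianLaw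
  have hxw := IndepFun.hasGaussianLaw hx hw h.indep_signal_noise
  refine hxw.comp_isLinearMap (f := fun (q : (Fin Nb → EuclideanSpace ℝ (Fin K)) ×
    (Fin Nb × ι → EuclideanSpace ℝ (Fin N))) (p : Fin Nb × κ) =>
    linearOutput A R Φ (q.1 p.1) (fun m => q.2 (p.1, m)) p.2) ⟨fun u v => ?_, fun c v => ?_⟩
  · ext p
    simp only [linearOutput, Prod.fst_add, Prod.snd_add, Pi.add_apply, WithLp.ofLp_add,
      dotProduct_add, mul_add, Finset.sum_add_distrib]
    ring
  · ext p
    simp only [linearOutput, Prod.smul_fst, Prod.smul_snd, Pi.smul_apply, WithLp.ofLp_smul,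
      dotProduct_smul, smul_eq_mul, mul_add, Finset.mul_sum, mul_left_comm c]

theorem integral_linearOutput {κ : Type*} (h : IsSignalNoiseModel P σx σ0 x w)
    (A : Matrix κ (Fin K) ℝ) (R : Matrix κ ι ℝ) (Φ : Matrix ι (Fin N) ℝ) (n : Fin Nb) (i : κ) :
    ∫ ω, linearOutput A R Φ (x n ω) (fun m => w n m ω) i ∂P = 0 := by
  have hw m := hasGaussianLaw_dotProduct (h.law_noise n) m (Φ m)
  simp only [linearOutput]
  rw [integral_add (hasGaussianLaw_dotProduct h.law_signal n (A i)).integrable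
    (integrable_finsetSum _ fun m _ => (hw m).integrable.const_mul _),
    integral_finsetSum _ fun m _ => (hw m).integrable.const_mul _,
    integral_dotProduct_eq_zero h.law_signal, zero_add]
  refine Finset.sum_eq_zero fun m _ => ?_
  rw [integral_const_mul, integral_dotProduct_eq_zero (h.law_noise n), mul_zero]

/-- Signal and noise are independent, as are the noises of different devices. Hence only the norms
of the rows of `Φ` enter the noise term, not their mutual inner products. -/
theorem covariance_linearOutput {κ : Type*} (h : IsSignalNoiseModel P σx σ0 x w)
    (A : Matrix κ (Fin K) ℝ) (R : Matrix κ ι ℝ) (Φ : Matrix ι (Fin N) ℝ) (n n' : Fin Nb)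
    (i j : κ) :
    cov[fun ω => linearOutput A R Φ (x n ω) (fun m => w n m ω) i,
      fun ω => linearOutput A R Φ (x n' ω) (fun m => w n' m ω) j; P] =
      if n = n' then σx ^ 2 * (A i ⬝ᵥ A j) + σ0 ^ 2 * ∑ m, R i m * R j m * (Φ m ⬝ᵥ Φ m)
      else 0 := by
  classical
  have := h.indep_signal.isProbabilityMeasure
  have hxL n i := (hasGaussianLaw_dotProduct h.law_signal n (A i)).memLp_two
  have hwL n m i : MemLp (fun ω => R i m * (Φ m ⬝ᵥ (w n m ω).ofLp)) 2 P :=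
    (hasGaussianLaw_dotProduct (h.law_noise n) m (Φ m)).memLp_two.const_mul _
  have hsL n i : MemLp (fun ω => ∑ m, R i m * (Φ m ⬝ᵥ (w n m ω).ofLp)) 2 P :=
    memLp_finsetSum _ fun m _ => hwL n m i
  have hxw n i n' j : cov[fun ω => A i ⬝ᵥ (x n ω).ofLp,
      fun ω => ∑ m, R j m * (Φ m ⬝ᵥ (w n' m ω).ofLp); P] = 0 := by
    refine IndepFun.covariance_eq_zero ?_ (hxL n i) (hsL n' j)
    exact h.indep_signal_noise.comp (φ := fun v => A i ⬝ᵥ (v n).ofLp)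
      (ψ := fun v => ∑ m, R j m * (Φ m ⬝ᵥ (v (n', m)).ofLp))
      (by unfold dotProduct; fun_prop) (by unfold dotProduct; fun_prop)
  have hwx : cov[fun ω => ∑ m, R i m * (Φ m ⬝ᵥ (w n m ω).ofLp),
      fun ω => A j ⬝ᵥ (x n' ω).ofLp; P] = 0 := (covariance_comm _ _).trans (hxw n' j n i)
  have hww m m' : cov[fun ω => Φ m ⬝ᵥ (w n m ω).ofLp, fun ω => Φ m' ⬝ᵥ (w n' m' ω).ofLp; P] =
      if (n, m) = (n', m') then σ0 ^ 2 * (Φ m ⬝ᵥ Φ m') else 0 :=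
    covariance_dotProduct (fun p : Fin Nb × ι => h.law_noise p.1 p.2) h.indep_noise (n, m) (n', m') _ _
  change cov[(fun ω => A i ⬝ᵥ (x n ω).ofLp) + fun ω => ∑ m, R i m * (Φ m ⬝ᵥ (w n m ω).ofLp),
    (fun ω => A j ⬝ᵥ (x n' ω).ofLp) + fun ω => ∑ m, R j m * (Φ m ⬝ᵥ (w n' m ω).ofLp); P] = _
  rw [covariance_add_left (hxL n i) (hsL n i) ((hxL n' j).add (hsL n' j)),
    covariance_add_right (hxL n i) (hxL n' j) (hsL n' j),
    covariance_add_right (hsL n i) (hxL n' j) (hsL n' j), hxw, hwx,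
    covariance_dotProduct h.law_signal h.indep_signal,
    covariance_fun_sum_fun_sum (fun m => hwL n m i) fun m => hwL n' m j]
  simp only [covariance_const_mul_left, covariance_const_mul_right, hww, Prod.mk.injEq]
  split_ifs with hn
  · simp only [hn, true_and, mul_ite, mul_zero, Finset.sum_ite_eq, Finset.mem_univ, if_true,
      add_zero, zero_add, Finset.mul_sum]
    congr 1
    exact Finset.sum_congr rfl fun m _ => by ring
  · simp [hn]

/-- Linear outputs with a diagonal covariance matrix become independent standard normal variables
after division by their standard deviations. -/
theorem standardized_linearOutput {κ : Type*} [Fintype κ] [DecidableEq κ]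
    (h : IsSignalNoiseModel P σx σ0 x w)
    (A : Matrix κ (Fin K) ℝ) (R : Matrix κ ι ℝ) (Φ : Matrix ι (Fin N) ℝ) {v : κ → ℝ}
    (hv : ∀ i, 0 < v i)
    (hcov : ∀ i j, σx ^ 2 * (A i ⬝ᵥ A j) + σ0 ^ 2 * ∑ m, R i m * R j m * (Φ m ⬝ᵥ Φ m) =
      if i = j then v i else 0) :
    iIndepFun (fun (p : Fin Nb × κ) ω => (Real.sqrt (v p.2))⁻¹ *
      linearOutput A R Φ (x p.1 ω) (fun m => w p.1 m ω) p.2) P ∧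
    ∀ p : Fin Nb × κ, HasLaw (fun ω => (Real.sqrt (v p.2))⁻¹ *
      linearOutput A R Φ (x p.1 ω) (fun m => w p.1 m ω) p.2) (gaussianReal 0 1) P := by
  have hG : HasGaussianLaw (fun ω (p : Fin Nb × κ) => (Real.sqrt (v p.2))⁻¹ *
      linearOutput A R Φ (x p.1 ω) (fun m => w p.1 m ω) p.2) P := by
    refine (h.hasGaussianLaw_linearOutput A R Φ).comp_isLinearMap
      (f := fun y p => (Real.sqrt (v p.2))⁻¹ * y p) ⟨fun y z => ?_, fun c y => ?_⟩
    · ext p; simp [mul_add]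
    · ext p; simp [mul_left_comm]
  refine ⟨hG.iIndepFun_of_covariance_eq_zero fun p q hpq => ?_, fun p => ⟨(hG.eval p).aemeasurable,
    ?_⟩⟩
  · rw [covariance_const_mul_left, covariance_const_mul_right, h.covariance_linearOutput, hcov]
    split_ifs with h1 h2
    · exact absurd (Prod.ext h1 h2) hpq
    · simp
    · simp
  · rw [(hG.eval p).map_eq_gaussianReal, integral_const_mul, h.integral_linearOutput,
      ← covariance_self (hG.eval p).aemeasurable, covariance_const_mul_left,
      covariance_const_mul_right, h.covariance_linearOutput, hcov, if_pos rfl, if_pos rfl,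
      ← mul_assoc, ← mul_inv, Real.mul_self_sqrt (hv _).le, inv_mul_cancel₀ (hv _).ne']
    simp

end CompressiveDetection.IsSignalNoiseModel

end GaussianModel

/-! ### Eigenvalue bounds -/

namespace CompressiveDetection

section RhoSq

variable {N K : ℕ} (H : Matrix (Fin N) (Fin K) ℝ)

theorem rhoSq_le_rhoSq {i j : ℕ} (hi : 1 ≤ i) (hij : i ≤ j) (hj : j ≤ N) :
    rhoSq H j ≤ rhoSq H i := by
  rw [rhoSq, rhoSq, dif_pos ⟨hi.trans hij, hj⟩, dif_pos ⟨hi, hij.trans hj⟩]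
  exact (isHermitian_mul_transpose H).eigenvalues₀_antitone (Fin.mk_le_mk.2 (by omega))

theorem IsSVD.rhoSq_nonneg {H : Matrix (Fin N) (Fin K) ℝ} {U : Matrix (Fin N) (Fin N) ℝ}
    {D : Matrix (Fin N) (Fin K) ℝ} {V : Matrix (Fin K) (Fin K) ℝ} (h : IsSVD H U D V) (i : ℕ) :
    0 ≤ rhoSq H i := by
  by_cases hi : 1 ≤ i ∧ i ≤ N
  · have := h.rhoSq_eq ⟨i - 1, by omega⟩
    simp only [Nat.sub_add_cancel hi.1] at this
    rw [this]
    exact Finset.sum_nonneg fun j _ => sq_nonneg _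
  · rw [rhoSq, dif_neg hi]

end RhoSq

/-! ### The rotated measurements -/

section Design

variable {N K M₁ M₂ : ℕ}

/-- The columns of `U` used by the measurement devices. -/
def deviceColumn (hM : M₁ + M₂ ≤ N) : Fin M₁ ⊕ Fin M₂ → Fin N :=
  Sum.elim (Fin.castLE (by omega)) fun i => ⟨N - M₂ + i, by omega⟩

/-- Since `M₁ + M₂ ≤ N`, the first `M₁` and last `M₂` columns do not overlap; diagonal matrices
therefore stay diagonal when restricted to them. -/
theorem deviceColumn_injective (hM : M₁ + M₂ ≤ N) : Function.Injective (deviceColumn hM) := by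
  rintro (i | i) (j | j) h <;>
    simp only [deviceColumn, Sum.elim_inl, Sum.elim_inr, Fin.ext_iff, Fin.val_castLE] at h
  · rw [Fin.ext h]
  · omega
  · omega
  · rw [Fin.ext (by omega : (i : ℕ) = j)]

/-- The rotation that undoes `T_s` and `T_o`. -/
def deviceRotation (Ts : Matrix (Fin M₁) (Fin M₁) ℝ) (To : Matrix (Fin M₂) (Fin M₂) ℝ) :
    Matrix (Fin M₁ ⊕ Fin M₂) (Fin M₁ ⊕ Fin M₂) ℝ :=
  Matrix.fromBlocks Tsᵀ 0 0 Toᵀ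

variable {Ts : Matrix (Fin M₁) (Fin M₁) ℝ} {To : Matrix (Fin M₂) (Fin M₂) ℝ}

theorem deviceRotation_mul_transpose (hTs : Ts ∈ Matrix.orthogonalGroup (Fin M₁) ℝ)
    (hTo : To ∈ Matrix.orthogonalGroup (Fin M₂) ℝ) :
    deviceRotation Ts To * (deviceRotation Ts To)ᵀ = 1 := by
  simp [deviceRotation, Matrix.fromBlocks_transpose, Matrix.fromBlocks_multiply,
    transpose_mul_of_mem_orthogonalGroup hTs, transpose_mul_of_mem_orthogonalGroup hTo]

theorem deviceRotation_transpose_mul (hTs : Ts ∈ Matrix.orthogonalGroup (Fin M₁) ℝ)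
    (hTo : To ∈ Matrix.orthogonalGroup (Fin M₂) ℝ) :
    (deviceRotation Ts To)ᵀ * deviceRotation Ts To = 1 := by
  simp [deviceRotation, Matrix.fromBlocks_transpose, Matrix.fromBlocks_multiply,
    mul_transpose_of_mem_orthogonalGroup hTs, mul_transpose_of_mem_orthogonalGroup hTo]

theorem designMatrix_eq (hM : M₁ + M₂ ≤ N) (U : Matrix (Fin N) (Fin N) ℝ) :
    designMatrix hM U Ts To = (1 / Real.sqrt (M₁ + M₂ : ℕ)) •
      ((deviceRotation Ts To)ᵀ * Uᵀ.submatrix (deviceColumn hM) id) := by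
  ext (i | i) j <;>
    simp [designMatrix, maxEnergySampler, minEnergySampler, deviceRotation, deviceColumn,
      Matrix.mul_apply, firstCols, lastCols]

/-- Used with `B = 1` for the row norms of the design and with `B = H` for the signal covariance. -/
theorem transpose_submatrix_mul {n : ℕ} {ι : Type*} (f : ι → Fin N) (U : Matrix (Fin N) (Fin N) ℝ)
    (B : Matrix (Fin N) (Fin n) ℝ) :
    (Uᵀ.submatrix f id * B) * (Uᵀ.submatrix f id * B)ᵀ =
      (Uᵀ * (B * Bᵀ) * U).submatrix f f := by
  calc _ = ((Uᵀ * B) * (Uᵀ * B)ᵀ).submatrix f f := rfl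
    _ = _ := by
      rw [Matrix.transpose_mul, Matrix.transpose_transpose]
      simp only [Matrix.mul_assoc]

theorem one_div_sqrt_mul_self (n : ℕ) :
    1 / Real.sqrt n * (1 / Real.sqrt n) = 1 / n := by
  rw [div_mul_div_comm, Real.mul_self_sqrt n.cast_nonneg, one_mul]

theorem designMatrix_mul_transpose (hM : M₁ + M₂ ≤ N) {U : Matrix (Fin N) (Fin N) ℝ}
    (hU : Uᵀ * U = 1) (hTs : Ts ∈ Matrix.orthogonalGroup (Fin M₁) ℝ)
    (hTo : To ∈ Matrix.orthogonalGroup (Fin M₂) ℝ) :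
    designMatrix hM U Ts To * (designMatrix hM U Ts To)ᵀ = (1 / (M₁ + M₂ : ℕ) : ℝ) • 1 := by
  have hsub := transpose_submatrix_mul (deviceColumn hM) U (1 : Matrix (Fin N) (Fin N) ℝ)
  simp only [Matrix.mul_one, Matrix.transpose_one, hU,
    Matrix.submatrix_one _ (deviceColumn_injective hM)] at hsub
  rw [designMatrix_eq, Matrix.transpose_smul, Matrix.smul_mul, Matrix.mul_smul, smul_smul,
    one_div_sqrt_mul_self, Matrix.transpose_mul, Matrix.transpose_transpose, Matrix.mul_assoc,
    ← Matrix.mul_assoc _ _ (deviceRotation Ts To), hsub, Matrix.one_mul,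
    deviceRotation_transpose_mul hTs hTo]

/-- The rotation cancels `Ts` and `To`, and the remaining columns of `U` are eigenvectors of `H *
Hᵀ`. -/
theorem rotated_design_mul_transpose (hM : M₁ + M₂ ≤ N) {H : Matrix (Fin N) (Fin K) ℝ}
    {U : Matrix (Fin N) (Fin N) ℝ} {D : Matrix (Fin N) (Fin K) ℝ} {V : Matrix (Fin K) (Fin K) ℝ}
    (h : IsSVD H U D V) (hTs : Ts ∈ Matrix.orthogonalGroup (Fin M₁) ℝ)
    (hTo : To ∈ Matrix.orthogonalGroup (Fin M₂) ℝ) :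
    (deviceRotation Ts To * designMatrix hM U Ts To * H) *
      (deviceRotation Ts To * designMatrix hM U Ts To * H)ᵀ =
      (1 / (M₁ + M₂ : ℕ) : ℝ) • Matrix.diagonal fun i => rhoSq H (deviceColumn hM i + 1) := by
  have hA : deviceRotation Ts To * designMatrix hM U Ts To * H =
      (1 / Real.sqrt (M₁ + M₂ : ℕ)) • (Uᵀ.submatrix (deviceColumn hM) id * H) := by
    rw [designMatrix_eq, Matrix.mul_smul, ← Matrix.mul_assoc,
      deviceRotation_mul_transpose hTs hTo, Matrix.one_mul, Matrix.smul_mul]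
  have hU : Uᵀ * (H * Hᵀ) * U = Matrix.diagonal fun i : Fin N => rhoSq H (i + 1) := by
    rw [h.mul_self_transpose, h.mul_transpose_eq_diagonal]
    simp only [← h.rhoSq_eq]
    calc _ = (Uᵀ * U) * (Matrix.diagonal fun i : Fin N => rhoSq H (i + 1)) * (Uᵀ * U) := by
          simp only [Matrix.mul_assoc]
      _ = _ := by rw [h.left_transpose_mul, Matrix.one_mul, Matrix.mul_one]
  rw [hA, Matrix.transpose_smul, Matrix.smul_mul, Matrix.mul_smul, smul_smul,
    one_div_sqrt_mul_self, transpose_submatrix_mul, hU,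
    Matrix.submatrix_diagonal _ _ (deviceColumn_injective hM)]
  rfl

theorem linearOutput_rotation {ι κ : Type*} [Fintype ι] (R : Matrix κ ι ℝ)
    (Φ : Matrix ι (Fin N) ℝ) (H : Matrix (Fin N) (Fin K) ℝ) (x : EuclideanSpace ℝ (Fin K))
    (w : ι → EuclideanSpace ℝ (Fin N)) :
    linearOutput (R * Φ * H) R Φ x w = R *ᵥ measurementAlt Φ H x w := by
  rw [measurementAlt, Matrix.mulVec_add, Matrix.mulVec_mulVec, Matrix.mulVec_mulVec]
  rfl

theorem deviceRotation_mulVec (z : Fin M₁ ⊕ Fin M₂ → ℝ) :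
    deviceRotation Ts To *ᵥ z = Sum.elim (Tsᵀ *ᵥ (z ∘ Sum.inl)) (Toᵀ *ᵥ (z ∘ Sum.inr)) := by
  simp [deviceRotation, Matrix.fromBlocks_mulVec]

theorem sum_sq_transpose_mulVec {n : ℕ} {T : Matrix (Fin n) (Fin n) ℝ}
    (hT : T ∈ Matrix.orthogonalGroup (Fin n) ℝ) (z : Fin n → ℝ) :
    ∑ i, (Tᵀ *ᵥ z) i ^ 2 = z ⬝ᵥ z := by
  have : (Tᵀ *ᵥ z) ⬝ᵥ (Tᵀ *ᵥ z) = z ⬝ᵥ z := by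
    rw [Matrix.dotProduct_mulVec, Matrix.vecMul_transpose, Matrix.mulVec_mulVec,
      mul_transpose_of_mem_orthogonalGroup hT, Matrix.one_mulVec]
  rw [← this]
  simp [dotProduct, sq]

end Design

section Energies

variable {Ω : Type*} [MeasurableSpace Ω] {P : Measure Ω} {N K M₁ M₂ Nb : ℕ}
  {H : Matrix (Fin N) (Fin K) ℝ} {U : Matrix (Fin N) (Fin N) ℝ} {D : Matrix (Fin N) (Fin K) ℝ}
  {V : Matrix (Fin K) (Fin K) ℝ} {Ts : Matrix (Fin M₁) (Fin M₁) ℝ}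
  {To : Matrix (Fin M₂) (Fin M₂) ℝ} {σ0 σx : ℝ} {x : Fin Nb → Ω → EuclideanSpace ℝ (Fin K)}
  {w : Fin Nb → (Fin M₁ ⊕ Fin M₂) → Ω → EuclideanSpace ℝ (Fin N)}

/-- Up to the factor `1 / M`, the block energies are sums of squares of independent standard
normal variables with the weights `σ₀² + σ_x² ρ_i²`. -/
theorem exists_standardized_energies (hM₁ : 0 < M₁) (hM : M₁ + M₂ ≤ N) (hSVD : IsSVD H U D V)
    (hTs : Ts ∈ Matrix.orthogonalGroup (Fin M₁) ℝ) (hTo : To ∈ Matrix.orthogonalGroup (Fin M₂) ℝ)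
    (hσ0 : 0 < σ0) (hmodel : IsSignalNoiseModel P σx σ0 x w) :
    ∃ g : (Fin Nb × Fin M₁) ⊕ (Fin Nb × Fin M₂) → Ω → ℝ, iIndepFun g P ∧
      (∀ i, HasLaw (g i) (gaussianReal 0 1) P) ∧ ∀ ω,
        let z n := measurementAlt (designMatrix hM U Ts To) H (x n ω) fun m => w n m ω
        (∑ n, (z n ∘ Sum.inl) ⬝ᵥ (z n ∘ Sum.inl) = 1 / (M₁ + M₂ : ℕ) * ∑ p : Fin Nb × Fin M₁,
          (σ0 ^ 2 + σx ^ 2 * rhoSq H (p.2 + 1)) * g (.inl p) ω ^ 2) ∧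
        ∑ n, (z n ∘ Sum.inr) ⬝ᵥ (z n ∘ Sum.inr) = 1 / (M₁ + M₂ : ℕ) * ∑ p : Fin Nb × Fin M₂,
          (σ0 ^ 2 + σx ^ 2 * rhoSq H (N - M₂ + p.2 + 1)) * g (.inr p) ω ^ 2 := by
  set Φ := designMatrix hM U Ts To with hΦ
  set R := deviceRotation Ts To with hR
  -- The variances of the rotated measurements; `1 / M` comes from the scaling of the samplers.
  let v (i : Fin M₁ ⊕ Fin M₂) : ℝ :=
    1 / (M₁ + M₂ : ℕ) * (σ0 ^ 2 + σx ^ 2 * rhoSq H (deviceColumn hM i + 1))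
  have hMpos : (0 : ℝ) < (M₁ + M₂ : ℕ) := by exact_mod_cast Nat.add_pos_left hM₁ _
  have hv i : 0 < v i := by
    have := hSVD.rhoSq_nonneg (deviceColumn hM i + 1)
    simp only [v]
    positivity
  have hΦΦ m : Φ m ⬝ᵥ Φ m = 1 / (M₁ + M₂ : ℕ) := by
    have := congrFun₂ (designMatrix_mul_transpose hM hSVD.left_transpose_mul hTs hTo) m m
    rw [Matrix.smul_apply, Matrix.one_apply_eq, smul_eq_mul, mul_one] at this
    exact this
  have hcov i j : σx ^ 2 * ((R * Φ * H) i ⬝ᵥ (R * Φ * H) j) +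
      σ0 ^ 2 * ∑ m, R i m * R j m * (Φ m ⬝ᵥ Φ m) = if i = j then v i else 0 := by
    have h1 : (R * Φ * H) i ⬝ᵥ (R * Φ * H) j = _ :=
      congrFun₂ (rotated_design_mul_transpose hM hSVD hTs hTo) i j
    have h2 : ∑ m, R i m * R j m = (1 : Matrix _ _ ℝ) i j :=
      congrFun₂ (deviceRotation_mul_transpose hTs hTo) i j
    simp only [hΦΦ, ← Finset.sum_mul]
    rw [h1, h2, Matrix.smul_apply, Matrix.diagonal_apply, Matrix.one_apply, smul_eq_mul]
    split_ifs
    · simp only [v]; ring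
    · ring
  obtain ⟨hind, hlaw⟩ := hmodel.standardized_linearOutput (R * Φ * H) R Φ hv hcov
  let e : (Fin Nb × Fin M₁) ⊕ (Fin Nb × Fin M₂) ≃ Fin Nb × (Fin M₁ ⊕ Fin M₂) :=
    (Equiv.prodSumDistrib _ _ _).symm
  refine ⟨_, hind.precomp e.injective, fun i => hlaw (e i), fun ω => ?_⟩
  have hsq (n : Fin Nb) (i : Fin M₁ ⊕ Fin M₂) : v i * ((Real.sqrt (v i))⁻¹ *
      linearOutput (R * Φ * H) R Φ (x n ω) (fun m => w n m ω) i) ^ 2 =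
      (R *ᵥ measurementAlt Φ H (x n ω) fun m => w n m ω) i ^ 2 := by
    rw [linearOutput_rotation, mul_pow, inv_pow, Real.sq_sqrt (hv i).le,
      mul_inv_cancel_left₀ (hv i).ne']
  constructor
  · rw [Finset.mul_sum, Fintype.sum_prod_type]
    refine Finset.sum_congr rfl fun n _ => ?_
    rw [← sum_sq_transpose_mulVec hTs]
    refine Finset.sum_congr rfl fun i _ => ?_
    rw [← mul_assoc]
    refine Eq.trans ?_ (hsq n (.inl i)).symm
    rw [hR, deviceRotation_mulVec]
    rfl
  · rw [Finset.mul_sum, Fintype.sum_prod_type]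
    refine Finset.sum_congr rfl fun n _ => ?_
    rw [← sum_sq_transpose_mulVec hTo]
    refine Finset.sum_congr rfl fun i _ => ?_
    rw [← mul_assoc]
    refine Eq.trans ?_ (hsq n (.inr i)).symm
    rw [hR, deviceRotation_mulVec]
    rfl

end Energies

end CompressiveDetection

/-! ### Bounds for the ratio of the energies -/

/-- A smaller numerator and a larger denominator give a smaller quotient. Division by zero yields
`0`, so `hO` is needed to exclude a vanishing right-hand quotient facing a positive left-hand one.
-/
theorem lt_div_of_weighted_le {S O A B a b d₁ d₂ γ : ℝ} (ha : 0 < a) (hb : 0 < b) (hS : 0 ≤ S)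
    (hB : 0 ≤ B) (hd₁ : 0 ≤ d₁) (hd₂ : 0 ≤ d₂) (hA : a * S ≤ A) (hBO : B ≤ b * O)
    (hO : B = 0 → O = 0) (h : b / a * γ < (S / d₁) / (O / d₂)) : γ < (A / d₁) / (B / d₂) := by
  have key : a / b * ((S / d₁) / (O / d₂)) ≤ (A / d₁) / (B / d₂) := by
    rcases hB.eq_or_lt with h0 | h0
    · simp [← h0, hO h0.symm]
    rcases hd₂.eq_or_lt with h2 | h2
    · simp [← h2]
    have hA₀ : 0 ≤ A := (mul_nonneg ha.le hS).trans hA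
    calc a / b * ((S / d₁) / (O / d₂)) = (a * S / d₁) / (b * O / d₂) := by
          simp only [div_eq_mul_inv, mul_inv, inv_inv]; ring
      _ ≤ _ := by gcongr
  calc γ = a / b * (b / a * γ) := by field_simp
    _ < a / b * ((S / d₁) / (O / d₂)) := by gcongr
    _ ≤ _ := key

/-- The preceding bound with the weighted and unweighted sums exchanged and `a`, `b` inverted. -/
theorem weighted_lt_of_lt_div {S O A B a b d₁ d₂ γ : ℝ} (ha : 0 < a) (hb : 0 < b) (hA₀ : 0 ≤ A)
    (hO : 0 ≤ O) (hd₁ : 0 ≤ d₁) (hd₂ : 0 ≤ d₂) (hA : A ≤ a * S) (hBO : b * O ≤ B)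
    (hB : O = 0 → B = 0) (h : γ < (A / d₁) / (B / d₂)) : b / a * γ < (S / d₁) / (O / d₂) := by
  refine lt_div_of_weighted_le (a := a⁻¹) (b := b⁻¹) (inv_pos.2 ha) (inv_pos.2 hb) hA₀ hO hd₁ hd₂
    ((inv_mul_le_iff₀ ha).2 hA) ((le_inv_mul_iff₀ hb).2 hBO) hB ?_
  convert h using 1
  field_simp

/-! ### The test -/

theorem rejectionProb_measurementAlt_bounds {Ω : Type*} [MeasurableSpace Ω] {P : Measure Ω}
    {N K M₁ M₂ Nb : ℕ} (hM₁ : 0 < M₁) (hM₂ : 0 < M₂) (hM : M₁ + M₂ ≤ N)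
    {H : Matrix (Fin N) (Fin K) ℝ}
    (U : Matrix (Fin N) (Fin N) ℝ) (D : Matrix (Fin N) (Fin K) ℝ) (V : Matrix (Fin K) (Fin K) ℝ)
    (hSVD : IsSVD H U D V)
    (Ts : Matrix (Fin M₁) (Fin M₁) ℝ) (hTs : Ts ∈ Matrix.orthogonalGroup (Fin M₁) ℝ)
    (To : Matrix (Fin M₂) (Fin M₂) ℝ) (hTo : To ∈ Matrix.orthogonalGroup (Fin M₂) ℝ)
    (σ0 σx : ℝ) (hσ0 : 0 < σ0)
    (x : Fin Nb → Ω → EuclideanSpace ℝ (Fin K))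
    (w : Fin Nb → (Fin M₁ ⊕ Fin M₂) → Ω → EuclideanSpace ℝ (Fin N))
    (hmodel : IsSignalNoiseModel P σx σ0 x w) (γ : ℝ) :
    QF (M₁ * Nb) (M₂ * Nb) (etaLB H σ0 σx M₁ M₂ * γ) ≤ rejectionProb P
      (fun n ω => measurementAlt (designMatrix hM U Ts To) H (x n ω) fun m => w n m ω) γ ∧
    rejectionProb P
      (fun n ω => measurementAlt (designMatrix hM U Ts To) H (x n ω) fun m => w n m ω) γ ≤
      QF (M₁ * Nb) (M₂ * Nb) (etaUB H σ0 σx * γ) := by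
  have := hmodel.indep_signal.isProbabilityMeasure
  obtain ⟨g, hind, hlaw, hg⟩ := exists_standardized_energies hM₁ hM hSVD hTs hTo hσ0 hmodel
  have hQF := measureReal_ratio_eq_QF hlaw hind (d₁ := M₁ * Nb) (d₂ := M₂ * Nb)
    (by simp [mul_comm]) (by simp [mul_comm])
  let α (i : ℕ) : ℝ := σ0 ^ 2 + σx ^ 2 * rhoSq H i
  let c : ℝ := 1 / (M₁ + M₂ : ℕ)
  have hc : 0 < c := one_div_pos.2 (by exact_mod_cast Nat.add_pos_left hM₁ _)
  have hα i : 0 < α i := by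
    have := hSVD.rhoSq_nonneg i
    simp only [α]
    positivity
  have hα_le {i j : ℕ} (hi : 1 ≤ i) (hij : i ≤ j) (hj : j ≤ N) : α j ≤ α i := by
    simp only [α]
    gcongr
    exact rhoSq_le_rhoSq H hi hij hj
  have hcα i : 0 < c * α i := mul_pos hc (hα i)
  have hle {ι : Type} [Fintype ι] (q : ι → ℕ) (y : ι → ℝ) {a : ℝ} (h : ∀ i, a ≤ α (q i)) :
      c * a * ∑ i, y i ^ 2 ≤ c * ∑ i, α (q i) * y i ^ 2 := by
    rw [mul_assoc, Finset.mul_sum]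
    gcongr with i
    exact h i
  have hge {ι : Type} [Fintype ι] (q : ι → ℕ) (y : ι → ℝ) {a : ℝ} (h : ∀ i, α (q i) ≤ a) :
      c * ∑ i, α (q i) * y i ^ 2 ≤ c * a * ∑ i, y i ^ 2 := by
    rw [mul_assoc, Finset.mul_sum _ _ a]
    gcongr with i
    exact h i
  have hnn {ι : Type} [Fintype ι] (y : ι → ℝ) : 0 ≤ ∑ i, y i ^ 2 :=
    Finset.sum_nonneg fun i _ => sq_nonneg _
  have hnn' {ι : Type} [Fintype ι] (q : ι → ℕ) (y : ι → ℝ) :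
      0 ≤ c * ∑ i, α (q i) * y i ^ 2 :=
    mul_nonneg hc.le (Finset.sum_nonneg fun i _ => mul_nonneg (hα _).le (sq_nonneg _))
  -- The common factor `1 / M` cancels from the ratio of the weights.
  have hη (i j : ℕ) : α i / α j = c * α i / (c * α j) := (mul_div_mul_left _ _ hc.ne').symm
  constructor
  · rw [← hQF]
    refine measureReal_mono (fun ω hω => ?_)
    change γ < _
    rw [testStatistic, (hg ω).1, (hg ω).2]
    rw [Set.mem_ofPred_eq, etaLB, hη (N - M₂ + 1) M₁] at hω
    -- The least weight of the first block is `α M₁`, the greatest of the second `α (N - M₂ + 1)`.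
    refine lt_div_of_weighted_le (hcα _) (hcα _) (hnn _) (hnn' _ _) (Nat.cast_nonneg _)
      (Nat.cast_nonneg _) (hle _ _ fun p => hα_le (by omega) (by omega) (by omega))
      (hge _ _ fun p => hα_le (by omega) (by omega) (by omega)) (fun h0 => ?_) hω
    -- The weights are at least `α N > 0`, so a vanishing weighted sum forces the plain sum to
    -- vanish.
    have h1 := hle (fun p : Fin Nb × Fin M₂ => N - M₂ + p.2 + 1) (fun p => g (.inr p) ω)
      (a := α N) fun p => hα_le (by omega) (by omega) le_rfl
    exact le_antisymm (nonpos_of_mul_nonpos_right (h1.trans h0.le) (hcα _)) (hnn _)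
  · rw [← hQF]
    refine measureReal_mono (fun ω hω => ?_)
    change γ < _ at hω
    rw [testStatistic, (hg ω).1, (hg ω).2] at hω
    rw [Set.mem_ofPred_eq, etaUB, hη N 1]
    -- Here the cruder bounds `α 1` for the first block and `α N` for the second are the ones that
    -- matter.
    refine weighted_lt_of_lt_div (hcα _) (hcα _) (hnn' _ _) (hnn _) (Nat.cast_nonneg _)
      (Nat.cast_nonneg _) (hge _ _ fun p => hα_le le_rfl (by omega) (by omega))
      (hle _ _ fun p => hα_le (by omega) (by omega) le_rfl) (fun h0 => ?_) hω
    have h1 := hge (fun p : Fin Nb × Fin M₂ => N - M₂ + p.2 + 1) (fun p => g (.inr p) ω)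
      (a := α 1) fun p => hα_le le_rfl (by omega) (by omega)
    refine le_antisymm (h1.trans_eq ?_) (hnn' _ _)
    rw [h0, mul_zero]

theorem mainTheorem1 {Ω : Type*} [MeasurableSpace Ω] (P : Measure Ω) [IsProbabilityMeasure P]
    {N K M₁ M₂ Nb : ℕ} (hM₁ : 0 < M₁) (hM₂ : 0 < M₂) (hNb : 0 < Nb) (hM : M₁ + M₂ ≤ N)
    (H : Matrix (Fin N) (Fin K) ℝ)
    (U : Matrix (Fin N) (Fin N) ℝ) (D : Matrix (Fin N) (Fin K) ℝ) (V : Matrix (Fin K) (Fin K) ℝ)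
    (hSVD : IsSVD H U D V)
    (Ts : Matrix (Fin M₁) (Fin M₁) ℝ) (hTs : Ts ∈ Matrix.orthogonalGroup (Fin M₁) ℝ)
    (To : Matrix (Fin M₂) (Fin M₂) ℝ) (hTo : To ∈ Matrix.orthogonalGroup (Fin M₂) ℝ)
    (σ0 σx : ℝ) (hσ0 : 0 < σ0) (hσx : 0 ≤ σx)
    (x : Fin Nb → Ω → EuclideanSpace ℝ (Fin K))
    (w : Fin Nb → (Fin M₁ ⊕ Fin M₂) → Ω → EuclideanSpace ℝ (Fin N))
    (hmodel : IsSignalNoiseModel P σx σ0 x w) (γ : ℝ) :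
    let Φ := designMatrix hM U Ts To
    let PFA := rejectionProb P
      (fun n ω => measurementNull Φ fun m => w n m ω) γ
    let PD := rejectionProb P
      (fun n ω => measurementAlt Φ H (x n ω) fun m => w n m ω) γ
    PFA = QF (M₁ * Nb) (M₂ * Nb) γ ∧
      QF (M₁ * Nb) (M₂ * Nb) (etaLB H σ0 σx M₁ M₂ * γ) ≤ PD ∧
      PD ≤ QF (M₁ * Nb) (M₂ * Nb) (etaUB H σ0 σx * γ) := by
  -- With `H = 0` and `D = 0` the alternative becomes the null hypothesis. All eigenvalues vanish,
  -- so both factors equal `σ0² / σ0² = 1`.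
  have h0 := rejectionProb_measurementAlt_bounds hM₁ hM₂ hM U 0 V
    (IsSVD.zero hSVD.left_orthogonal hSVD.right_orthogonal) Ts hTs To hTo σ0 σx hσ0 x w hmodel γ
  have hη : σ0 ^ 2 / σ0 ^ 2 = 1 := div_self (by positivity)
  simp only [etaLB, etaUB, rhoSq_zero, mul_zero, add_zero, hη, one_mul, measurementAlt,
    Matrix.zero_mulVec, Matrix.mulVec_zero, zero_add] at h0
  exact ⟨le_antisymm h0.2 h0.1,
    rejectionProb_measurementAlt_bounds hM₁ hM₂ hM U D V hSVD Ts hTs To hTo σ0 σx hσ0 x w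
      hmodel γ⟩
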